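/- Conventions. Manifolds are modelled on convenient vector spaces, i.e. Hausdorff locally convex real topological vector spaces $E$ in which every smooth curve has a smooth antiderivative; smooth maps are the maps that send smooth curves to smooth curves, and vector fields and differential forms are the kinematic ones (a $k$-form is a smooth family of continuous alternating $k$-linear forms on the tangent spaces). A 2-form $\omega$ on $M$ is weakly symplectic if $d\omega=0$ and, for each $x\in M$, the map $T_xM\ni v\mapsto \omega_x(v,\cdot)$ is injective. A 1-form $\eta$ on a manifold $N$ is a (weakly) contact form if for every $x\in N$ the space $\mathrm{Ver}_x:=\{v\in T_xN : d\eta_x(v,\cdot)=0\}$ is non-zero and $T_xN=\ker\eta_x\oplus \mathrm{Ver}_x$; then $(N,\eta)$ is called a contact manifold. Theorem (level sets of contact type). Let $(M,\omega)$ be a weakly symplectic manifold, let $H\in C^\infty(M)$, and put $N:=H^{-1}(0)$. Assume that 1. $N\subset M$ is a submanifold, with inclusion $i\colon N\hookrightarrow M$ (around each point of $N$ there is a chart of $M$ that maps $N$ onto the part of its image lying in a closed linear subspace $F$ of the model space), and $0$ is a regular value of $H$, that is, $dH_x\neq 0$ for all $x\in N$; 2. there is a smooth vector field $Y$ on $M$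 that is transverse to $N$, that is, $T_xM=T_xN\oplus\mathbb{R}Y_x$ for all $x\in N$, and such that on some open neighbourhood $W$ of $N$ one has $\mathcal{L}_Y\omega=f\omega$ (equivalently $d\iota_Y\omega=f\omega$) with a smooth function $f$ that is nowhere zero on $W$; 3. there is a (necessarily unique) smooth vector field $X_H$ on $M$ with $\iota_{X_H}\omega=dH$. Then $(N,\,i^*(\iota_Y\omega))$ is a contact manifold. -/

import Mathlib

open Set Filter Topology

universe u v

/-! ### Smooth curves and smooth maps in locally convex spaces -/

section Calculus

variable {E : Type*} [AddCommGroup E] [Module ℝ E] [TopologicalSpace E]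
  {G : Type*} [AddCommGroup G] [Module ℝ G] [TopologicalSpace G]

/-- The curve `c` has derivative `v` at `t`: the difference quotients
`(c (t + h) - c t) / h` converge to `v` as `h → 0`, `h ≠ 0`. -/
def HasVelocity (c : ℝ → E) (v : E) (t : ℝ) : Prop :=
  Tendsto (fun h : ℝ => h⁻¹ • (c (t + h) - c t)) (𝓝[≠] 0) (𝓝 v)

/-- `c` is a `C^∞` curve on the open set `s` of times: there are iterated derivatives
`D 0 = c, D 1, D 2, …` on `s` (each is continuous on `s`, being differentiable). -/
def SmoothCurveOn (c : ℝ → E) (s : Set ℝ) : Prop :=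
  ∃ D : ℕ → ℝ → E, D 0 = c ∧ ∀ n, ∀ t ∈ s, HasVelocity (D n) (D (n + 1) t) t

/-- Smoothness of a map on an open set `U`, in the sense of convenient calculus: smooth curves
in `U` are sent to smooth curves. Curves parametrised by an arbitrary open set of times are
allowed; as smoothness of a curve is local in time, this is the same as using curves
defined on all of `ℝ`. -/
def SmoothMapOn (f : E → G) (U : Set E) : Prop :=
  ∀ s : Set ℝ, IsOpen s → ∀ c : ℝ → E, SmoothCurveOn c s → (∀ t ∈ s, c t ∈ U) →
    SmoothCurveOn (fun t => f (c t)) s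

/-- For curves in normed spaces, `HasVelocity` is the usual derivative. -/
theorem hasVelocity_iff_hasDerivAt {V : Type*} [NormedAddCommGroup V] [NormedSpace ℝ V]
    {c : ℝ → V} {v : V} {t : ℝ} : HasVelocity c v t ↔ HasDerivAt c v t :=
  hasDerivAt_iff_tendsto_slope_zero.symm

theorem HasVelocity.prodMk {c : ℝ → E} {d : ℝ → G} {v : E} {w : G} {t : ℝ}
    (hc : HasVelocity c v t) (hd : HasVelocity d w t) :
    HasVelocity (fun t => (c t, d t)) (v, w) t :=
  Tendsto.prodMk_nhds hc hd

theorem HasVelocity.fst {c : ℝ → E × G} {v : E × G} {t : ℝ}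
    (hc : HasVelocity c v t) : HasVelocity (fun t => (c t).1) v.1 t :=
  (continuous_fst.tendsto v).comp hc

theorem HasVelocity.snd {c : ℝ → E × G} {v : E × G} {t : ℝ}
    (hc : HasVelocity c v t) : HasVelocity (fun t => (c t).2) v.2 t :=
  (continuous_snd.tendsto v).comp hc

theorem SmoothCurveOn.prodMk {c : ℝ → E} {d : ℝ → G} {s : Set ℝ}
    (hc : SmoothCurveOn c s) (hd : SmoothCurveOn d s) :
    SmoothCurveOn (fun t => (c t, d t)) s := by
  obtain ⟨C, hC0, hC⟩ := hc
  obtain ⟨D, hD0, hD⟩ := hd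
  refine ⟨fun n t => (C n t, D n t), ?_, fun n t ht => (hC n t ht).prodMk (hD n t ht)⟩
  simp [hC0, hD0]

theorem SmoothCurveOn.fst {c : ℝ → E × G} {s : Set ℝ}
    (hc : SmoothCurveOn c s) : SmoothCurveOn (fun t => (c t).1) s := by
  obtain ⟨C, hC0, hC⟩ := hc
  exact ⟨fun n t => (C n t).1, by simp [hC0], fun n t ht => (hC n t ht).fst⟩

theorem SmoothCurveOn.snd {c : ℝ → E × G} {s : Set ℝ}
    (hc : SmoothCurveOn c s) : SmoothCurveOn (fun t => (c t).2) s := by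
  obtain ⟨C, hC0, hC⟩ := hc
  exact ⟨fun n t => (C n t).2, by simp [hC0], fun n t ht => (hC n t ht).snd⟩

/-- A convenient vector space: a Hausdorff locally convex space in which every smooth curve has
a smooth antiderivative. -/
structure IsConvenientSpace (E : Type*) [AddCommGroup E] [Module ℝ E] [TopologicalSpace E] :
    Prop where
  topologicalAddGroup : IsTopologicalAddGroup E
  continuousSMul : ContinuousSMul ℝ E
  t2 : T2Space E
  locallyConvex : LocallyConvexSpace ℝ E
  antiderivative : ∀ c : ℝ → E, SmoothCurveOn c univ →
    ∃ C : ℝ → E, SmoothCurveOn C univ ∧ ∀ t, HasVelocity C (c t) t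

end Calculus

/-! ### Manifolds, vector fields and differential forms

An atlas `A` on `M` is a set of homeomorphisms from open subsets of `M` onto open subsets of the
model space `E`. It need not be maximal; the maximal atlas is a special case. Vector fields and
forms are families of local objects, one for each chart `e ∈ A`, that correspond to each other
under the transition maps. The local object of a chart `e` matters on `e.target` only. -/

section Manifold

variable {E : Type*} [AddCommGroup E] [Module ℝ E] [TopologicalSpace E]
  {M : Type*} [TopologicalSpace M]

/-- `A` is a smooth atlas that makes `M` a manifold modelled by the convenient space `E`. -/
structure IsConvenientManifold (A : Set (OpenPartialHomeomorph M E)) : Prop where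
  convenient : IsConvenientSpace E
  cover : ∀ x : M, ∃ e ∈ A, x ∈ e.source
  smooth_transition : ∀ e ∈ A, ∀ e' ∈ A,
    SmoothMapOn (fun x => e' (e.symm x)) (e.symm.trans e').source

/-- `f` is smooth on the open set `W ⊆ M`. -/
def SmoothFunctionOn (A : Set (OpenPartialHomeomorph M E)) (f : M → ℝ) (W : Set M) : Prop :=
  ∀ e ∈ A, SmoothMapOn (fun x => f (e.symm x)) (e.target ∩ e.symm ⁻¹' W)

/-- Smooth (kinematic) vector fields. The condition `compat` says that the transition map `τ` from
the chart `e` to the chart `e'` satisfies `dτ_x (Y_e (x)) = Y_e' (τ x)`. -/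
structure VectorField (A : Set (OpenPartialHomeomorph M E)) where
  toFun : OpenPartialHomeomorph M E → E → E
  smooth : ∀ e ∈ A, SmoothMapOn (toFun e) e.target
  compat : ∀ e ∈ A, ∀ e' ∈ A, ∀ x ∈ (e.symm.trans e').source,
    HasVelocity (fun t : ℝ => e' (e.symm (x + t • toFun e x))) (toFun e' (e' (e.symm x))) 0

/-- Smooth (kinematic) 1-forms: continuous linear in the vector, jointly smooth; `compat` says that
`α_e (x) (v) = α_e' (τ x) (dτ_x v)` for the transition map `τ` from `e` to `e'`. -/
structure OneForm (A : Set (OpenPartialHomeomorph M E)) where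
  toFun : OpenPartialHomeomorph M E → E → E →L[ℝ] ℝ
  smooth : ∀ e ∈ A, SmoothMapOn (fun p : E × E => toFun e p.1 p.2) (e.target ×ˢ univ)
  compat : ∀ e ∈ A, ∀ e' ∈ A, ∀ x ∈ (e.symm.trans e').source, ∀ v v' : E,
    HasVelocity (fun t : ℝ => e' (e.symm (x + t • v))) v' 0 →
      toFun e x v = toFun e' (e' (e.symm x)) v'

/-- Smooth (kinematic) 2-forms. -/
structure TwoForm (A : Set (OpenPartialHomeomorph M E)) where
  toFun : OpenPartialHomeomorph M E → E → E [⋀^Fin 2]→L[ℝ] ℝ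
  smooth : ∀ e ∈ A,
    SmoothMapOn (fun p : E × E × E => toFun e p.1 ![p.2.1, p.2.2]) (e.target ×ˢ univ)
  compat : ∀ e ∈ A, ∀ e' ∈ A, ∀ x ∈ (e.symm.trans e').source, ∀ v v' w w' : E,
    HasVelocity (fun t : ℝ => e' (e.symm (x + t • v))) v' 0 →
    HasVelocity (fun t : ℝ => e' (e.symm (x + t • w))) w' 0 →
      toFun e x ![v, w] = toFun e' (e' (e.symm x)) ![v', w']

/-- The differential of a function in the chart `e`: `dH_x (v)`. -/
noncomputable def differential (H : M → ℝ) (e : OpenPartialHomeomorph M E) (x v : E) : ℝ :=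
  deriv (fun t : ℝ => H (e.symm (x + t • v))) 0

variable {A : Set (OpenPartialHomeomorph M E)}

/-- The exterior derivative of a 1-form in the chart `e`:
`dα_x (v, w) = D_v (α (w)) - D_w (α (v))` for constant `v` and `w`. -/
noncomputable def OneForm.extDeriv (α : OneForm A) (e : OpenPartialHomeomorph M E)
    (x v w : E) : ℝ :=
  deriv (fun t : ℝ => α.toFun e (x + t • v) w) 0 - deriv (fun t : ℝ => α.toFun e (x + t • w) v) 0

/-- The exterior derivative of a 2-form in the chart `e`, for constant `u`, `v`, `w`. -/
noncomputable def TwoForm.extDeriv (ω : TwoForm A) (e : OpenPartialHomeomorph M E)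
    (x u v w : E) : ℝ :=
  deriv (fun t : ℝ => ω.toFun e (x + t • u) ![v, w]) 0
    - deriv (fun t : ℝ => ω.toFun e (x + t • v) ![u, w]) 0
    + deriv (fun t : ℝ => ω.toFun e (x + t • w) ![u, v]) 0

/-- The interior product `ι_Y ω = ω (Y, -)`. -/
def interior_product (Y : VectorField A) (ω : TwoForm A) : OneForm A where
  toFun e x := (ω.toFun e x).toContinuousLinearMap ![Y.toFun e x, 0] 1
  smooth := by
    intro e he s hs c hc hcU
    have hx : ∀ t ∈ s, (c t).1 ∈ e.target := fun t ht => (hcU t ht).1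
    have hY := Y.smooth e he s hs _ hc.fst hx
    have h := ω.smooth e he s hs _ (hc.fst.prodMk (hY.prodMk hc.snd))
      (fun t ht => ⟨hx t ht, mem_univ _⟩)
    have key : ∀ a b : E, Function.update ![a, 0] 1 b = ![a, b] := by
      intro a b; ext i; fin_cases i <;> simp
    simpa [ContinuousAlternatingMap.toContinuousLinearMap,
      ContinuousMultilinearMap.toContinuousLinearMap, key] using h
  compat := by
    intro e he e' he' x hx v v' hv
    have h := ω.compat e he e' he' x hx _ _ v v' (Y.compat e he e' he' x hx) hv
    have key : ∀ a b : E, Function.update ![a, 0] 1 b = ![a, b] := by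
      intro a b; ext i; fin_cases i <;> simp
    simpa [ContinuousAlternatingMap.toContinuousLinearMap,
      ContinuousMultilinearMap.toContinuousLinearMap, key] using h

theorem interior_product_apply (Y : VectorField A) (ω : TwoForm A)
    (e : OpenPartialHomeomorph M E) (x v : E) :
    (interior_product Y ω).toFun e x v = ω.toFun e x ![Y.toFun e x, v] := by
  have key : ∀ a b : E, Function.update ![a, 0] 1 b = ![a, b] := by
    intro a b; ext i; fin_cases i <;> simp
  simp [interior_product, ContinuousAlternatingMap.toContinuousLinearMap,
    ContinuousMultilinearMap.toContinuousLinearMap, key]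

/-- The Lie derivative `L_Y ω = d (ι_Y ω) + ι_Y (dω)` of a 2-form, in the chart `e`. -/
noncomputable def lieDerivative (Y : VectorField A) (ω : TwoForm A)
    (e : OpenPartialHomeomorph M E) (x v w : E) : ℝ :=
  (interior_product Y ω).extDeriv e x v w + ω.extDeriv e x (Y.toFun e x) v w

/-- `ω` is a weakly symplectic form: closed, and `v ↦ ω_x (v, -)` is injective for each `x`. -/
structure IsWeaklySymplectic (ω : TwoForm A) : Prop where
  closed : ∀ e ∈ A, ∀ x ∈ e.target, ∀ u v w : E, ω.extDeriv e x u v w = 0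
  nondegenerate : ∀ e ∈ A, ∀ x ∈ e.target, ∀ v : E, (∀ w : E, ω.toFun e x ![v, w] = 0) → v = 0

/-- `X` is a Hamiltonian vector field of `H`: `ι_X ω = dH`. -/
def IsHamiltonianVectorField (ω : TwoForm A) (H : M → ℝ) (X : VectorField A) : Prop :=
  ∀ e ∈ A, ∀ x ∈ e.target, ∀ v : E, ω.toFun e x ![X.toFun e x, v] = differential H e x v

/-- `η` is a (weakly) contact form: at each point the kernel `V` of `dη` (the vertical space) is a
non-zero subspace, and the tangent space is the direct sum of the kernel of `η` (the horizontal
space) and `V`. -/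
def IsContactForm (η : OneForm A) : Prop :=
  ∀ e ∈ A, ∀ x ∈ e.target, ∃ V : Submodule ℝ E,
    (∀ v : E, v ∈ V ↔ ∀ w : E, η.extDeriv e x v w = 0) ∧ V ≠ ⊥ ∧
    IsCompl (LinearMap.ker (η.toFun e x : E →ₗ[ℝ] ℝ)) V

/-- The atlas `A` and the 1-form `η` make `M` a (strict, co-orientable) contact manifold. -/
structure IsContactManifold (A : Set (OpenPartialHomeomorph M E)) (η : OneForm A) : Prop where
  manifold : IsConvenientManifold A
  contact : IsContactForm η

/-- `η = i^* α` for a map `i` between manifolds: in charts `d` and `e`, the map `i` is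
differentiable in all directions, and `η_y (v) = α_{i(y)} (di_y v)`. -/
def IsPullback {F : Type*} [AddCommGroup F] [Module ℝ F] [TopologicalSpace F]
    {N : Type*} [TopologicalSpace N] {B : Set (OpenPartialHomeomorph N F)}
    (i : N → M) (α : OneForm A) (η : OneForm B) : Prop :=
  ∀ d ∈ B, ∀ e ∈ A, ∀ y ∈ d.target, i (d.symm y) ∈ e.source → ∀ v : F, ∃ w : E,
    HasVelocity (fun t : ℝ => e (i (d.symm (y + t • v)))) w 0 ∧
    η.toFun d y v = α.toFun e (e (i (d.symm y))) w

/-! ### Submanifolds -/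

/-- `e` is a submanifold chart for `N`: it maps `N ∩ e.source` onto `F ∩ e.target`. In such a chart
the tangent space of `N` at each point of `N ∩ e.source` is `F`. -/
def IsSubmanifoldChart (N : Set M) (F : Submodule ℝ E) (e : OpenPartialHomeomorph M E) : Prop :=
  ∀ x ∈ e.source, x ∈ N ↔ e x ∈ F

/-- `N` is a submanifold of `M` modelled by the closed linear subspace `F` of the model space. -/
structure IsSubmanifold (A : Set (OpenPartialHomeomorph M E)) (N : Set M) (F : Submodule ℝ E) :
    Prop where
  closed : IsClosed (F : Set E)
  chart : ∀ x ∈ N, ∃ e ∈ A, x ∈ e.source ∧ IsSubmanifoldChart N F e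

/-- The atlas of a submanifold `N`: the restrictions to `N` of the submanifold charts of `M`. -/
def submanifoldAtlas (A : Set (OpenPartialHomeomorph M E)) (N : Set M) (F : Submodule ℝ E) :
    Set (OpenPartialHomeomorph N F) :=
  {d | ∃ e ∈ A, IsSubmanifoldChart N F e ∧ d.source = Subtype.val ⁻¹' e.source ∧
    ∀ x ∈ d.source, (d x : E) = e x}

/-- `Y` is transverse to `N`: `T_x M = T_x N ⊕ ℝ Y_x` for all `x ∈ N`. -/
def IsTransverse (Y : VectorField A) (N : Set M) (F : Submodule ℝ E) : Prop :=
  ∀ e ∈ A, IsSubmanifoldChart N F e → ∀ x ∈ N, x ∈ e.source →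
    IsCompl F (Submodule.span ℝ {Y.toFun e (e x)})

end Manifold

/-! ### Smooth curves in closed subspaces of convenient spaces. -/

section Calculus

variable {E : Type*} [AddCommGroup E] [Module ℝ E] [TopologicalSpace E]

/-! Let `η` be the pullback of `ι_Y ω` to `N`. As `dω = 0`, the Lie derivative is `d(ι_Y ω)`, so
`dη` is `f` times the restriction of `ω`. Since `f` has no zeros on `N`, the kernel of `dη` is the
`ω`-orthogonal of `TN` inside `TN`.

The rest is linear algebra at one point (`isCompl_ker_span_of_transverse`), with `F` the tangent
space of `N`. The form `ω(X_H, -) = dH` vanishes on `F` and is non-zero, so `ω(X_H, Y) ≠ 0` by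
transversality, and `ω(X_H, X_H) = 0` then forces `X_H ∈ F`. A vector of `F` orthogonal to `F` is
determined by its pairing with `Y`, by injectivity of `ω`; so the kernel of `dη` is the line of
`X_H`. As `η(X_H) = ω(Y, X_H) ≠ 0`, this line is a complement of `ker η`.

That `N` is a convenient manifold rests on `IsConvenientSpace.of_isClosed`, and
`OneForm.extDeriv_restrict` lets `d` be computed in a chart of `M`. -/

theorem HasVelocity.congr_of_eventuallyEq {c c' : ℝ → E} {v : E} {t : ℝ}
    (hc : HasVelocity c v t) (h : c =ᶠ[𝓝 t] c') : HasVelocity c' v t := by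
  refine Tendsto.congr' ?_ hc
  have ht : Tendsto (fun s : ℝ => t + s) (𝓝[≠] 0) (𝓝 t) := by
    have h0 : Tendsto (fun s : ℝ => t + s) (𝓝 0) (𝓝 (t + 0)) :=
      (continuous_const.add continuous_id).tendsto 0
    rw [add_zero] at h0
    exact h0.mono_left nhdsWithin_le_nhds
  filter_upwards [ht.eventually h] with s hs
  rw [hs, h.self_of_nhds]

theorem SmoothCurveOn.congr {c c' : ℝ → E} {s : Set ℝ} (hs : IsOpen s)
    (hc : SmoothCurveOn c s) (h : ∀ t ∈ s, c t = c' t) : SmoothCurveOn c' s := by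
  obtain ⟨D, rfl, hD⟩ := hc
  -- Only the zeroth term changes: it must equal `c'` at all times, whereas `c` and `c'` agree only
  -- on `s`.
  refine ⟨fun n => Nat.casesOn n c' fun k => D (k + 1), rfl, fun n t ht => ?_⟩
  cases n with
  | zero => exact (hD 0 t ht).congr_of_eventuallyEq (eventually_of_mem (hs.mem_nhds ht) h)
  | succ k => exact hD (k + 1) t ht

theorem hasVelocity_coe_iff {F : Submodule ℝ E} {c : ℝ → F} {v : F} {t : ℝ} :
    HasVelocity (fun t => (c t : E)) v t ↔ HasVelocity c v t := by
  unfold HasVelocity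
  rw [IsInducing.subtypeVal.tendsto_nhds_iff]
  rfl

theorem SmoothCurveOn.coe {F : Submodule ℝ E} {c : ℝ → F} {s : Set ℝ}
    (hc : SmoothCurveOn c s) : SmoothCurveOn (fun t => (c t : E)) s := by
  obtain ⟨D, rfl, hD⟩ := hc
  exact ⟨fun n t => D n t, rfl, fun n t ht => hasVelocity_coe_iff.2 (hD n t ht)⟩

theorem HasVelocity.mem_of_isClosed {F : Submodule ℝ E} (hF : IsClosed (F : Set E))
    {c : ℝ → E} {v : E} {t : ℝ} (hc : HasVelocity c v t) (h : ∀ᶠ r in 𝓝 t, c r ∈ F) :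
    v ∈ F := by
  have ht : Tendsto (fun s : ℝ => t + s) (𝓝[≠] 0) (𝓝 t) := by
    have h0 : Tendsto (fun s : ℝ => t + s) (𝓝 0) (𝓝 (t + 0)) :=
      (continuous_const.add continuous_id).tendsto 0
    rw [add_zero] at h0
    exact h0.mono_left nhdsWithin_le_nhds
  refine hF.mem_of_tendsto hc ?_
  filter_upwards [ht.eventually h] with s hs
  exact F.smul_mem _ (F.sub_mem hs h.self_of_nhds)

/-- A smooth curve with values in a closed subspace is smooth as a curve in the subspace. -/
theorem SmoothCurveOn.of_coe {F : Submodule ℝ E} (hF : IsClosed (F : Set E)) {c : ℝ → F}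
    {s : Set ℝ} (hs : IsOpen s) (hc : SmoothCurveOn (fun t => (c t : E)) s) :
    SmoothCurveOn c s := by
  classical
  obtain ⟨D, hD0, hD⟩ := hc
  have hmem : ∀ n, ∀ t ∈ s, D n t ∈ F := by
    intro n
    induction n with
    | zero => intro t _; rw [hD0]; exact (c t).2
    | succ k ih =>
      exact fun t ht => (hD k t ht).mem_of_isClosed hF (eventually_of_mem (hs.mem_nhds ht) ih)
  -- Outside `s` the higher derivatives may leave `F`; the value there is irrelevant.
  refine ⟨fun n t => if h : D n t ∈ F then ⟨D n t, h⟩ else 0, ?_, fun n t ht => ?_⟩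
  · funext t
    simp [hD0]
  · rw [← hasVelocity_coe_iff]
    simp only [hmem (n + 1) t ht, dif_pos]
    refine (hD n t ht).congr_of_eventuallyEq (eventually_of_mem (hs.mem_nhds ht) fun r hr => ?_)
    simp [hmem n r hr]

theorem HasVelocity.clm_apply {c : ℝ → E} {v : E} {t : ℝ} (hc : HasVelocity c v t)
    (l : E →L[ℝ] ℝ) : HasDerivAt (fun t => l (c t)) (l v) t := by
  rw [← hasVelocity_iff_hasDerivAt]
  refine ((l.continuous.tendsto v).comp hc).congr fun h => ?_
  simp

theorem HasVelocity.sub_const {c : ℝ → E} {v : E} {t : ℝ} (hc : HasVelocity c v t) (a : E) :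
    HasVelocity (fun t => c t - a) v t := by
  simpa [HasVelocity] using hc

/-- A curve in a locally convex space whose velocity lies in a closed subspace stays in an affine
translate of that subspace. -/
theorem sub_mem_of_hasVelocity_mem [IsTopologicalAddGroup E] [ContinuousSMul ℝ E]
    [LocallyConvexSpace ℝ E] {F : Submodule ℝ E} (hF : IsClosed (F : Set E)) {C c : ℝ → E}
    (hC : ∀ t, HasVelocity C (c t) t) (hc : ∀ t, c t ∈ F) (t r : ℝ) : C t - C r ∈ F := by
  by_contra hne
  obtain ⟨l, u, hlu, hu⟩ := geometric_hahn_banach_closed_point F.convex hF hne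
  have hzero : ∀ x ∈ F, l x = 0 := by
    intro x hx
    by_contra hlx
    -- A functional bounded above on a subspace vanishes there: this multiple of `x` would attain
    -- the bound `u`.
    have h := hlu ((u / l x) • x) (F.smul_mem _ hx)
    rw [map_smul, smul_eq_mul, div_mul_cancel₀ _ hlx] at h
    exact lt_irrefl _ h
  have hd : ∀ t, HasDerivAt (fun t => l (C t)) 0 t := fun t => by
    simpa [hzero _ (hc t)] using (hC t).clm_apply l
  have heq : l (C t) = l (C r) :=
    is_const_of_deriv_eq_zero (fun t => (hd t).differentiableAt) (fun t => (hd t).deriv) t r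
  have h0 := hlu 0 F.zero_mem
  rw [map_sub, heq, sub_self] at hu
  rw [map_zero] at h0
  exact lt_asymm h0 hu

/-- A closed subspace of a convenient space is convenient. -/
theorem IsConvenientSpace.of_isClosed (hE : IsConvenientSpace E) {F : Submodule ℝ E}
    (hF : IsClosed (F : Set E)) : IsConvenientSpace F := by
  have := hE.topologicalAddGroup
  have := hE.continuousSMul
  have := hE.t2
  have := hE.locallyConvex
  refine ⟨inferInstance, inferInstance, inferInstance, ?_, fun c hc => ?_⟩
  · exact LocallyConvexSpace.induced F.subtype
  · obtain ⟨C, -, hCv⟩ := hE.antiderivative _ hc.coe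
    have hv : ∀ t, HasVelocity
        (fun t => (⟨C t - C 0, sub_mem_of_hasVelocity_mem hF hCv (fun t => (c t).2) t 0⟩ : F))
        (c t) t := fun t => hasVelocity_coe_iff.1 ((hCv t).sub_const (C 0))
    obtain ⟨D, rfl, hD⟩ := hc
    -- Subtracting `C 0` moves the antiderivative into `F`. Its higher derivatives are those of `c`,
    -- shifted by one.
    refine ⟨fun t => ⟨C t - C 0, sub_mem_of_hasVelocity_mem hF hCv (fun t => (D 0 t).2) t 0⟩,
      ⟨fun n => Nat.casesOn n (fun t => ⟨C t - C 0,
        sub_mem_of_hasVelocity_mem hF hCv (fun t => (D 0 t).2) t 0⟩) D,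
        rfl, fun n t ht => ?_⟩, hv⟩
    cases n with
    | zero => exact hv t
    | succ k => exact hD k t ht

theorem eventually_add_smul_mem [ContinuousAdd E] [ContinuousSMul ℝ E] {U : Set E}
    (hU : IsOpen U) {x : E} (hx : x ∈ U) (v : E) : ∀ᶠ t : ℝ in 𝓝 0, x + t • v ∈ U := by
  have h : Continuous fun t : ℝ => x + t • v := by fun_prop
  exact h.continuousAt.eventually (hU.mem_nhds (by simpa using hx))

theorem smoothCurveOn_line [IsTopologicalAddGroup E] [ContinuousSMul ℝ E] (x v : E) (s : Set ℝ) :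
    SmoothCurveOn (fun t : ℝ => x + t • v) s := by
  refine ⟨fun n => Nat.casesOn n (fun t => x + t • v) fun k => Nat.casesOn k (fun _ => v)
    fun _ _ => 0, rfl, fun n t _ => ?_⟩
  match n with
  | 0 =>
    refine tendsto_const_nhds.congr' ?_
    filter_upwards [self_mem_nhdsWithin] with h hh
    have hh' : h ≠ 0 := hh
    simp [add_smul, smul_smul, hh']
  | 1 => simpa [HasVelocity] using tendsto_const_nhds
  | k + 2 => simpa [HasVelocity] using tendsto_const_nhds

/-- Maps that are smooth in the sense of convenient calculus have directional derivatives. -/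
theorem SmoothMapOn.exists_hasVelocity [IsTopologicalAddGroup E] [ContinuousSMul ℝ E]
    {G : Type*} [AddCommGroup G] [Module ℝ G] [TopologicalSpace G] {g : E → G} {U : Set E}
    (hg : SmoothMapOn g U) (hU : IsOpen U) {x : E} (hx : x ∈ U) (v : E) :
    ∃ w, HasVelocity (fun t : ℝ => g (x + t • v)) w 0 := by
  have hline : Continuous fun t : ℝ => x + t • v := by fun_prop
  obtain ⟨D, hD0, hD⟩ := hg _ (hU.preimage hline) _ (smoothCurveOn_line x v _) fun t ht => ht
  refine ⟨D 1 0, ?_⟩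
  rw [← hD0]
  exact hD 0 0 (by simpa using hx)

end Calculus

/-! ### Charts and forms on the submanifold. -/

section Manifold

variable {E : Type*} [AddCommGroup E] [Module ℝ E] [TopologicalSpace E]
  {M : Type*} [TopologicalSpace M] {A : Set (OpenPartialHomeomorph M E)}
  {N : Set M} {F : Submodule ℝ E}

/-- The chart `d` of `N` is the restriction of the submanifold chart `e` of `M`. -/
structure IsChartRestriction (e : OpenPartialHomeomorph M E) (d : OpenPartialHomeomorph N F) :
    Prop where
  isSubmanifoldChart : IsSubmanifoldChart N F e
  source_eq : d.source = Subtype.val ⁻¹' e.source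
  coe_apply : ∀ x ∈ d.source, (d x : E) = e x

theorem mem_submanifoldAtlas_iff {d : OpenPartialHomeomorph N F} :
    d ∈ submanifoldAtlas A N F ↔ ∃ e ∈ A, IsChartRestriction e d :=
  ⟨fun ⟨e, he, h₁, h₂, h₃⟩ => ⟨e, he, h₁, h₂, h₃⟩, fun ⟨e, he, h⟩ => ⟨e, he, h.1, h.2, h.3⟩⟩

namespace IsChartRestriction

variable {e e' : OpenPartialHomeomorph M E} {d d' : OpenPartialHomeomorph N F}

theorem mem_source (h : IsChartRestriction e d) {x : N} (hx : x ∈ d.source) :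
    (x : M) ∈ e.source := by
  rw [h.source_eq] at hx
  exact hx

theorem apply_coe_symm (h : IsChartRestriction e d) {y : F} (hy : y ∈ d.target) :
    e (d.symm y) = y := by
  rw [← h.coe_apply _ (d.map_target hy), d.right_inv hy]

theorem coe_mem_target (h : IsChartRestriction e d) {y : F} (hy : y ∈ d.target) :
    (y : E) ∈ e.target := by
  rw [← h.apply_coe_symm hy]
  exact e.map_source (h.mem_source (d.map_target hy))

theorem symm_coe (h : IsChartRestriction e d) {y : F} (hy : y ∈ d.target) :
    e.symm y = d.symm y := by
  rw [← h.apply_coe_symm hy]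
  exact e.left_inv (h.mem_source (d.map_target hy))

theorem coe_mem_transition_source (h : IsChartRestriction e d) (h' : IsChartRestriction e' d')
    {y : F} (hy : y ∈ (d.symm.trans d').source) : (y : E) ∈ (e.symm.trans e').source := by
  rw [OpenPartialHomeomorph.trans_source, OpenPartialHomeomorph.symm_source] at hy ⊢
  refine ⟨h.coe_mem_target hy.1, ?_⟩
  rw [mem_preimage, h.symm_coe hy.1]
  exact h'.mem_source hy.2

theorem coe_transition (h : IsChartRestriction e d) (h' : IsChartRestriction e' d')
    {y : F} (hy : y ∈ (d.symm.trans d').source) :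
    ((d' (d.symm y) : F) : E) = e' (e.symm y) := by
  rw [OpenPartialHomeomorph.trans_source, OpenPartialHomeomorph.symm_source] at hy
  rw [h.symm_coe hy.1]
  exact h'.coe_apply _ hy.2

end IsChartRestriction

open Classical in
/-- The restriction to `N` of a submanifold chart, for a non-empty `N`. -/
noncomputable def IsSubmanifoldChart.restrict {e : OpenPartialHomeomorph M E}
    (h : IsSubmanifoldChart N F e) (x₀ : N) : OpenPartialHomeomorph N F where
  toFun x := if hx : (x : M) ∈ e.source then ⟨e x, (h x hx).1 x.2⟩ else 0
  -- Outside the target some point of `N` is needed as a value; this is the role of `x₀`.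
  invFun y := if hy : (y : E) ∈ e.target then
    ⟨e.symm y, (h _ (e.map_target hy)).2 (by rw [e.right_inv hy]; exact y.2)⟩ else x₀
  source := Subtype.val ⁻¹' e.source
  target := Subtype.val ⁻¹' e.target
  map_source' x hx := by
    have hx' : (x : M) ∈ e.source := hx
    simp [hx']
  map_target' y hy := by
    have hy' : (y : E) ∈ e.target := hy
    simp [hy']
  left_inv' x hx := by
    have hx' : (x : M) ∈ e.source := hx
    simp [hx']
  right_inv' y hy := by
    have hy' : (y : E) ∈ e.target := hy
    simp [hy']
  open_source := e.open_source.preimage continuous_subtype_val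
  open_target := e.open_target.preimage continuous_subtype_val
  continuousOn_toFun := by
    rw [IsInducing.subtypeVal.continuousOn_iff]
    refine (e.continuousOn.comp continuous_subtype_val.continuousOn fun x hx => hx).congr ?_
    intro x hx
    have hx' : (x : M) ∈ e.source := hx
    simp [hx']
  continuousOn_invFun := by
    rw [IsInducing.subtypeVal.continuousOn_iff]
    refine (e.continuousOn_symm.comp continuous_subtype_val.continuousOn fun y hy => hy).congr ?_
    intro y hy
    have hy' : (y : E) ∈ e.target := hy
    simp [hy']

theorem IsSubmanifoldChart.isChartRestriction_restrict {e : OpenPartialHomeomorph M E}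
    (h : IsSubmanifoldChart N F e) (x₀ : N) : IsChartRestriction e (h.restrict x₀) := by
  refine ⟨h, rfl, fun x hx => ?_⟩
  have hx' : (x : M) ∈ e.source := hx
  simp [IsSubmanifoldChart.restrict, hx']

/-- A submanifold of a convenient manifold is a convenient manifold. -/
theorem IsSubmanifold.isConvenientManifold (hNF : IsSubmanifold A N F)
    (hA : IsConvenientManifold A) : IsConvenientManifold (submanifoldAtlas A N F) where
  convenient := hA.convenient.of_isClosed hNF.closed
  cover x := by
    obtain ⟨e, he, hxe, h⟩ := hNF.chart x x.2
    exact ⟨h.restrict x, mem_submanifoldAtlas_iff.2 ⟨e, he, h.isChartRestriction_restrict x⟩, hxe⟩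
  smooth_transition d hd d' hd' s hs c hc hcU := by
    obtain ⟨e, he, h⟩ := mem_submanifoldAtlas_iff.1 hd
    obtain ⟨e', he', h'⟩ := mem_submanifoldAtlas_iff.1 hd'
    refine SmoothCurveOn.of_coe hNF.closed hs (SmoothCurveOn.congr hs
      (hA.smooth_transition e he e' he' s hs _ hc.coe fun t ht =>
        h.coe_mem_transition_source h' (hcU t ht)) fun t ht => ?_)
    exact (h.coe_transition h' (hcU t ht)).symm

open Classical in
/-- The restriction of a 1-form to a submanifold. -/
noncomputable def OneForm.restrict (α : OneForm A) (hA : IsConvenientManifold A) (N : Set M)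
    (F : Submodule ℝ E) : OneForm (submanifoldAtlas A N F) where
  -- Several charts of `M` may restrict to `d`, and one is chosen. The compatibility of `α` between
  -- the chosen charts gives that of the restriction.
  toFun d y := if hd : ∃ e ∈ A, IsChartRestriction e d then
    (α.toFun hd.choose y).comp F.subtypeL else 0
  smooth d hd s hs c hc hcU := by
    have hd := mem_submanifoldAtlas_iff.1 hd
    simp only [dif_pos hd]
    exact α.smooth _ hd.choose_spec.1 s hs _ (hc.fst.coe.prodMk hc.snd.coe) fun t ht =>
      ⟨hd.choose_spec.2.coe_mem_target (hcU t ht).1, mem_univ _⟩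
  compat d hd d' hd' y hy v v' hv := by
    have hd := mem_submanifoldAtlas_iff.1 hd
    have hd' := mem_submanifoldAtlas_iff.1 hd'
    simp only [dif_pos hd, dif_pos hd']
    obtain ⟨he, h⟩ := hd.choose_spec
    obtain ⟨he', h'⟩ := hd'.choose_spec
    have := hA.convenient.topologicalAddGroup
    have := hA.convenient.continuousSMul
    have hvel := (hasVelocity_coe_iff.2 hv).congr_of_eventuallyEq
      ((eventually_add_smul_mem (d.symm.trans d').open_source hy v).mono fun t ht =>
        h.coe_transition h' ht)
    have key := α.compat _ he _ he' y (h.coe_mem_transition_source h' hy) v v' hvel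
    rw [← h.coe_transition h' hy] at key
    exact key

theorem OneForm.exists_restrict_eq (α : OneForm A) (hA : IsConvenientManifold A)
    {d : OpenPartialHomeomorph N F} (hd : d ∈ submanifoldAtlas A N F) :
    ∃ e ∈ A, IsChartRestriction e d ∧
      ∀ y v : F, (α.restrict hA N F).toFun d y v = α.toFun e y v := by
  have hd := mem_submanifoldAtlas_iff.1 hd
  refine ⟨_, hd.choose_spec.1, hd.choose_spec.2, fun y v => ?_⟩
  simp only [OneForm.restrict, dif_pos hd]
  rfl

/-- The chart `e` of `M` need not be adapted to `N`. The inclusion read in `d` and `e` is the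
transition from the adapted chart `e₀` to `e`, restricted to `F`; it is smooth, hence has
directional derivatives. -/
theorem OneForm.isPullback_restrict (α : OneForm A) (hA : IsConvenientManifold A) :
    IsPullback (Subtype.val : N → M) α (α.restrict hA N F) := by
  intro d hd e he y hy hye v
  obtain ⟨e₀, he₀, h, hα⟩ := α.exists_restrict_eq hA hd
  have := hA.convenient.topologicalAddGroup
  have := hA.convenient.continuousSMul
  have hmem : (y : E) ∈ (e₀.symm.trans e).source := by
    rw [OpenPartialHomeomorph.trans_source, OpenPartialHomeomorph.symm_source]
    refine ⟨h.coe_mem_target hy, ?_⟩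
    rw [mem_preimage, h.symm_coe hy]
    exact hye
  obtain ⟨w, hw⟩ := (hA.smooth_transition e₀ he₀ e he).exists_hasVelocity
    (e₀.symm.trans e).open_source hmem (v : E)
  refine ⟨w, hw.congr_of_eventuallyEq
    ((eventually_add_smul_mem d.open_target hy v).mono fun t ht => ?_), ?_⟩
  · exact congrArg e (h.symm_coe ht)
  · rw [hα, α.compat e₀ he₀ e he y hmem v w hw, h.symm_coe hy]

/-- In a 2-form the arguments may be exchanged at the cost of a sign. -/
theorem TwoForm.apply_swap (ω : TwoForm A) (e : OpenPartialHomeomorph M E) (x v w : E) :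
    ω.toFun e x ![v, w] = -ω.toFun e x ![w, v] := by
  have h := (ω.toFun e x).toAlternatingMap.map_swap ![w, v] (i := 0) (j := 1) (by decide)
  refine Eq.trans (congrArg _ ?_) h
  ext i
  fin_cases i <;> rfl

/-- A 2-form at a point, as a bilinear form. -/
def TwoForm.toBilin (ω : TwoForm A) (e : OpenPartialHomeomorph M E) (x : E) :
    E →ₗ[ℝ] E →ₗ[ℝ] ℝ :=
  have hadd : ∀ v v' w : E, ω.toFun e x ![v + v', w] =
      ω.toFun e x ![v, w] + ω.toFun e x ![v', w] := fun v v' w =>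
    (ω.toFun e x).toAlternatingMap.toMultilinearMap.cons_add ![w] v v'
  have hsmul : ∀ (r : ℝ) (v w : E), ω.toFun e x ![r • v, w] = r • ω.toFun e x ![v, w] :=
    fun r v w => (ω.toFun e x).toAlternatingMap.toMultilinearMap.cons_smul ![w] r v
  LinearMap.mk₂ ℝ (fun v w => ω.toFun e x ![v, w]) hadd hsmul
    (fun v w w' => by
      rw [ω.apply_swap, hadd, neg_add, ← ω.apply_swap, ← ω.apply_swap])
    (fun r v w => by rw [ω.apply_swap, hsmul, ← smul_neg, ← ω.apply_swap])

@[simp]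
theorem TwoForm.toBilin_apply (ω : TwoForm A) (e : OpenPartialHomeomorph M E) (x v w : E) :
    ω.toBilin e x v w = ω.toFun e x ![v, w] :=
  rfl

theorem TwoForm.isAlt_toBilin (ω : TwoForm A) (e : OpenPartialHomeomorph M E) (x : E) :
    (ω.toBilin e x).IsAlt := fun v => by
  have h := ω.apply_swap e x v v
  rw [TwoForm.toBilin_apply]
  linarith

/-- The differential of a function vanishes along its zero set. -/
theorem IsChartRestriction.differential_eq_zero (hA : IsConvenientManifold A)
    {e : OpenPartialHomeomorph M E} {d : OpenPartialHomeomorph N F} (h : IsChartRestriction e d)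
    {H : M → ℝ} (hH : ∀ x ∈ N, H x = 0) {y : F} (hy : y ∈ d.target) (v : F) :
    differential H e y v = 0 := by
  have := hA.convenient.topologicalAddGroup
  have := hA.convenient.continuousSMul
  have heq : (fun t : ℝ => H (e.symm (y + t • (v : E)))) =ᶠ[𝓝 0] fun _ => 0 :=
    (eventually_add_smul_mem d.open_target hy v).mono fun t ht =>
      (congrArg H (h.symm_coe ht)).trans (hH _ (d.symm _).2)
  rw [differential, heq.deriv_eq, deriv_const]

/-- Pullback commutes with `d` because the directions lie in `F`: both sides differentiate the same
functions along the same lines. A single `e` serves both `η` and `dη`. -/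
theorem OneForm.extDeriv_restrict (α : OneForm A) (hA : IsConvenientManifold A)
    {d : OpenPartialHomeomorph N F} (hd : d ∈ submanifoldAtlas A N F) :
    ∃ e ∈ A, IsChartRestriction e d ∧
      (∀ y v : F, (α.restrict hA N F).toFun d y v = α.toFun e y v) ∧
      ∀ y v w : F, (α.restrict hA N F).extDeriv d y v w = α.extDeriv e y v w := by
  obtain ⟨e, he, h, hα⟩ := α.exists_restrict_eq hA hd
  exact ⟨e, he, h, hα, fun y v w => by simp [OneForm.extDeriv, hα]⟩

end Manifold

/-! ### Hypersurfaces in a weakly symplectic vector space. -/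

section LinearAlgebra

theorem LinearMap.isCompl_ker_span_singleton {V : Type*} [AddCommGroup V] [Module ℝ V]
    {g : V →ₗ[ℝ] ℝ} {x : V} (hx : g x ≠ 0) :
    IsCompl (LinearMap.ker g) (Submodule.span ℝ {x}) := by
  constructor
  · rw [Submodule.disjoint_def]
    intro z hz hzx
    obtain ⟨r, rfl⟩ := Submodule.mem_span_singleton.1 hzx
    rw [LinearMap.mem_ker, map_smul, smul_eq_mul, mul_eq_zero, or_iff_left hx] at hz
    rw [hz, zero_smul]
  · rw [codisjoint_iff, eq_top_iff]
    intro z _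
    refine Submodule.mem_sup.2 ⟨z - (g z / g x) • x, ?_, (g z / g x) • x,
      Submodule.smul_mem _ _ (Submodule.mem_span_singleton_self x), sub_add_cancel _ _⟩
    simp [hx]

/-- The linear algebra of a hypersurface `F` in a weakly symplectic space with a transverse
vector `Y`: if `ι_X ω` has kernel containing `F` and is non-zero, then `X` spans the
`ω`-orthogonal complement of `F` in `F`, and this line is complementary in `F` to the kernel
of `ι_Y ω`. -/
theorem isCompl_ker_span_of_transverse {E : Type*} [AddCommGroup E] [Module ℝ E]
    {ω : E →ₗ[ℝ] E →ₗ[ℝ] ℝ} (hω : ω.IsAlt) (hinj : Function.Injective ω)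
    {F : Submodule ℝ E} {X Y : E} (hY : IsCompl F (Submodule.span ℝ {Y}))
    (hX : ∀ w ∈ F, ω X w = 0) (hX0 : ω X ≠ 0) :
    ∃ V : Submodule ℝ F, (∀ v : F, v ∈ V ↔ ∀ w : F, ω v w = 0) ∧ V ≠ ⊥ ∧
      IsCompl (LinearMap.ker ((ω Y).comp F.subtype)) V := by
  have hdec : ∀ z : E, ∃ a ∈ F, ∃ b : ℝ, a + b • Y = z := by
    intro z
    obtain ⟨a, ha, y, hy, rfl⟩ := Submodule.mem_sup.1 (hY.sup_eq_top ▸ Submodule.mem_top (x := z))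
    obtain ⟨b, rfl⟩ := Submodule.mem_span_singleton.1 hy
    exact ⟨a, ha, b, rfl⟩
  have hXY : ω X Y ≠ 0 := by
    intro h0
    refine hX0 (LinearMap.ext fun z => ?_)
    obtain ⟨a, ha, b, rfl⟩ := hdec z
    simp [hX a ha, h0]
  have hXF : X ∈ F := by
    -- With `X = a + b • Y`, alternation gives `0 = ω X X = b * ω X Y`, hence `b = 0`.
    obtain ⟨a, ha, b, hab⟩ := hdec X
    have h := hω X
    nth_rewrite 2 [← hab] at h
    rw [map_add, map_smul, hX a ha, zero_add, smul_eq_mul, mul_eq_zero, or_iff_left hXY] at h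
    rw [← hab, h, zero_smul, add_zero]
    exact ha
  have hYX : ω Y X ≠ 0 := by
    rw [← hω.neg]
    exact neg_ne_zero.2 hXY
  refine ⟨Submodule.span ℝ {⟨X, hXF⟩}, fun v => ?_, ?_, ?_⟩
  · rw [Submodule.mem_span_singleton]
    constructor
    · rintro ⟨r, rfl⟩ w
      simp [hX w w.2]
    · intro hv
      -- The coefficient is forced by pairing with `Y`. Both vectors pair to zero with `F`, so they
      -- agree by injectivity.
      refine ⟨ω v Y / ω X Y, Subtype.ext (hinj (LinearMap.ext fun z => ?_))⟩
      obtain ⟨a, ha, b, rfl⟩ := hdec z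
      have hva : ω v a = 0 := hv ⟨a, ha⟩
      simp only [Submodule.coe_smul, map_add, map_smul, LinearMap.smul_apply, smul_eq_mul,
        hX a ha, hva]
      field_simp
      ring
  · rw [Ne, Submodule.span_singleton_eq_bot]
    intro h
    exact hX0 (by rw [show X = 0 from congrArg Subtype.val h, map_zero])
  · exact LinearMap.isCompl_ker_span_singleton (x := (⟨X, hXF⟩ : F)) hYX

end LinearAlgebra

/-! ### The contact condition on the level set. -/

theorem mainTheorem4
    {E : Type u} [AddCommGroup E] [Module ℝ E] [TopologicalSpace E]
    {M : Type v} [TopologicalSpace M]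
    (A : Set (OpenPartialHomeomorph M E)) (hA : IsConvenientManifold A)
    (ω : TwoForm A) (hω : IsWeaklySymplectic ω)
    (H : M → ℝ) (hH : SmoothFunctionOn A H univ)
    (N : Set M) (hN : N = H ⁻¹' {0})
    (F : Submodule ℝ E) (hNF : IsSubmanifold A N F)
    -- zero is a regular value of `H`: `dH_x ≠ 0` for all `x ∈ N`
    (hreg : ∀ e ∈ A, ∀ x ∈ N, x ∈ e.source → ∃ v : E, differential H e (e x) v ≠ 0)
    (Y : VectorField A) (hY : IsTransverse Y N F)
    -- `L_Y ω = f ω` with `f` nowhere zero, on an open neighbourhood `W` of `N`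
    (W : Set M) (hW : IsOpen W) (hNW : N ⊆ W)
    (f : M → ℝ) (hf : SmoothFunctionOn A f W) (hf0 : ∀ x ∈ W, f x ≠ 0)
    (hLie : ∀ e ∈ A, ∀ x ∈ e.target, e.symm x ∈ W → ∀ v w : E,
      lieDerivative Y ω e x v w = f (e.symm x) * ω.toFun e x ![v, w])
    -- the Hamiltonian vector field of `H` exists
    (hX : ∃ X : VectorField A, IsHamiltonianVectorField ω H X) :
    ∃ η : OneForm (submanifoldAtlas A N F),
      IsPullback (Subtype.val : N → M) (interior_product Y ω) η ∧
      IsContactManifold (submanifoldAtlas A N F) η := by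
  have hpull := (interior_product Y ω).isPullback_restrict hA (N := N) (F := F)
  refine ⟨(interior_product Y ω).restrict hA N F, hpull, hNF.isConvenientManifold hA, ?_⟩
  intro d hd y hy
  obtain ⟨e, he, h, hη, hdη⟩ := (interior_product Y ω).extDeriv_restrict hA hd
  obtain ⟨X, hX⟩ := hX
  have hyt : (y : E) ∈ e.target := h.coe_mem_target hy
  have hxN : e.symm y ∈ N := by
    rw [h.symm_coe hy]
    exact (d.symm y).2
  have hxe : e.symm y ∈ e.source := e.map_target hyt
  have hey : e (e.symm y) = y := e.right_inv hyt
  -- Closedness removes the term `ι_Y (dω)` from the Lie derivative.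
  have hω_ext : ∀ v w : E, (interior_product Y ω).extDeriv e y v w =
      f (e.symm y) * ω.toFun e y ![v, w] := fun v w => by
    rw [← hLie e he y hyt (hNW hxN), lieDerivative, hω.closed e he y hyt, add_zero]
  have hYtr := hY e he h.isSubmanifoldChart _ hxN hxe
  rw [hey] at hYtr
  obtain ⟨u, hu⟩ := hreg e he _ hxN hxe
  rw [hey] at hu
  obtain ⟨V, hV, hV0, hVc⟩ := isCompl_ker_span_of_transverse (ω.isAlt_toBilin e y)
    ((injective_iff_map_eq_zero _).2 fun v hv =>
      hω.nondegenerate e he y hyt v fun w => LinearMap.congr_fun hv w)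
    hYtr (X := X.toFun e y)
    (fun w hw => (hX e he y hyt w).trans
      (h.differential_eq_zero hA (fun x hx => by rw [hN] at hx; exact hx) hy ⟨w, hw⟩))
    (fun h0 => hu ((hX e he y hyt u).symm.trans (LinearMap.congr_fun h0 u)))
  refine ⟨V, fun v => (hV v).trans (forall_congr' fun w => ?_), hV0, ?_⟩
  · rw [hdη, hω_ext, mul_eq_zero, or_iff_right (hf0 _ (hNW hxN))]
    rfl
  · have hηy : (((interior_product Y ω).restrict hA N F).toFun d y : F →ₗ[ℝ] ℝ) =
        (ω.toBilin e y (Y.toFun e y)).comp F.subtype :=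
      LinearMap.ext fun v => (hη y v).trans (interior_product_apply Y ω e y v)
    rw [hηy]
    exact hVc
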